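/- Let $\mathcal P$ be one of the following meromorphic functions on $\mathbb C$, and let $\Lambda$ denote its group of periods, respectively $\Lambda=\{0\}$ in the first case (in each case $\Lambda$ is the set of poles of $\mathcal P$): * (rational case) $\mathcal P(z)=z^{-2}$, $\Lambda=\{0\}$; * (simply periodic case) $\mathcal P(z)=\frac{\pi^2}{\omega^2}\Big(\frac{1}{\sin^2(\pi z/\omega)}-\frac13\Big)$ with $\omega\in\mathbb C\setminus\{0\}$, $\Lambda=\mathbb Z\omega$; * (elliptic case) $\mathcal P=\wp$, the Weierstrass function of a lattice $\Lambda\subset\mathbb C$ generated by two $\mathbb R$-linearly independent periods. Let $M\in\mathbb N$, $s_\ell\in\mathbb N$ $(1\le \ell\le M)$ (positive integers), $q_0\in\mathbb C$, and let $\zeta_1,\dots,\zeta_M\in\mathbb C$ be pairwise distinct modulo $\Lambda$. Put $$q(z)=q_0-\sum_{\ell=1}^M s_\ell(s_\ell+1)\,\mathcal P(z-\zeta_\ell),$$ and suppose that the Duistermaat–Grünbaum locus conditions $$\sum_{\substack{\ell'=1\\ \ell'\ne \ell}}^M s_{\ell'}(s_{\ell'}+1)\,\mathcal P^{(2k-1)}(\zeta_\ell-\zeta_{\ell'})=0\qquad\text{for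 } 1\le k\le s_\ell,\ 1\le \ell\le M,$$ hold. Let $U=\mathbb C\setminus\bigcup_\ell(\zeta_\ell+\Lambda)$ be the complement of the set of poles of $q$, and let $(f_j)_{j\ge0}$ be KdV recursion coefficients of $q$, that is, holomorphic functions on $U$ with $$f_0=1,\qquad f_{j+1}'=\tfrac14 f_j'''+q f_j'+\tfrac12 q' f_j\quad (j\ge 0),$$ where the integration constant in each step is arbitrary. Then $f_0=1$ and there are constants $d_j\in\mathbb C$ and $a_{j,\ell,k}\in\mathbb C$ such that for all $j\ge1$ $$f_j(z)=d_j+\sum_{\ell=1}^M\ \sum_{k=1}^{\min(j,s_\ell)}a_{j,\ell,k}\,\mathcal P(z-\zeta_\ell)^k,\qquad z\in U.$$ -/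

import Mathlib

/-- The three situations in which the unified symbol `𝒫` is used: rational, simply periodic with
period `ω ≠ 0`, and elliptic with a pair of (`ℝ`-linearly independent) fundamental periods. -/
inductive PotentialCase : Type where
  | rational : PotentialCase
  | simplyPeriodic (ω : ℂ) (hω : ω ≠ 0) : PotentialCase
  | elliptic (L : PeriodPair) : PotentialCase

namespace PotentialCase

/-- The function `𝒫`: `z⁻²`, `(π²/ω²) (sin(πz/ω)⁻² - 1/3)`, or the Weierstrass function `℘(z)`. -/
noncomputable def P : PotentialCase → ℂ → ℂ
  | rational => fun z => (z ^ 2)⁻¹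
  | simplyPeriodic ω _ => fun z =>
      (Real.pi : ℂ) ^ 2 / ω ^ 2 * ((Complex.sin ((Real.pi : ℂ) * z / ω) ^ 2)⁻¹ - 1 / 3)
  | elliptic L => L.weierstrassP

/-- The group of periods of `𝒫`, which is also its set of poles: `{0}`, `ℤω`, or the period
lattice. -/
def periods : PotentialCase → AddSubgroup ℂ
  | rational => ⊥
  | simplyPeriodic ω _ => AddSubgroup.zmultiples ω
  | elliptic L => L.lattice.toAddSubgroup

/-- The potential `q(z) = q₀ - ∑_ℓ s_ℓ (s_ℓ + 1) 𝒫(z - ζ_ℓ)`. -/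
noncomputable def potential (C : PotentialCase) {M : ℕ} (q₀ : ℂ) (s : Fin M → ℕ) (ζ : Fin M → ℂ)
    (z : ℂ) : ℂ :=
  q₀ - ∑ l, (s l : ℂ) * ((s l : ℂ) + 1) * C.P (z - ζ l)

/-- The complement of the set of poles of the potential. -/
def regularSet (C : PotentialCase) {M : ℕ} (ζ : Fin M → ℂ) : Set ℂ :=
  {z | ∀ l, z - ζ l ∉ C.periods}

/-- The Duistermaat-Grünbaum locus conditions
`∑_{ℓ' ≠ ℓ} s_ℓ' (s_ℓ' + 1) 𝒫^(2k-1)(ζ_ℓ - ζ_ℓ') = 0` for `1 ≤ k ≤ s_ℓ` and all `ℓ`. -/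
def DGLocus (C : PotentialCase) {M : ℕ} (s : Fin M → ℕ) (ζ : Fin M → ℂ) : Prop :=
  ∀ l : Fin M, ∀ k : ℕ, 1 ≤ k → k ≤ s l →
    ∑ l' ∈ Finset.univ.erase l,
      (s l' : ℂ) * ((s l' : ℂ) + 1) * iteratedDeriv (2 * k - 1) C.P (ζ l - ζ l') = 0

end PotentialCase

/-- `f 0, f 1, f 2, …` are KdV recursion coefficients of `q` on the open set `U`: they are
holomorphic (single-valued) functions on `U` with `f₀ = 1` and
`f_{j+1}' = (1/4) f_j''' + q f_j' + (1/2) q' f_j`. The integration constant in each step is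
arbitrary. -/
structure IsKdVRecursion (U : Set ℂ) (q : ℂ → ℂ) (f : ℕ → ℂ → ℂ) : Prop where
  differentiableOn : ∀ j, DifferentiableOn ℂ (f j) U
  zero : ∀ z ∈ U, f 0 z = 1
  succ : ∀ j, ∀ z ∈ U, deriv (f (j + 1)) z =
    1 / 4 * iteratedDeriv 3 (f j) z + q z * deriv (f j) z + 1 / 2 * deriv q z * f j z

/-- In a commutative `ℂ`-algebra with a derivation, the KdV recursion can be solved (there the
integration step is possible). This only serves to show that recursion coefficients exist. -/
theorem exists_kdvRecursion_of_derivation {R : Type*} [CommRing R] [Algebra ℂ R]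
    (D : Derivation ℂ R R) (q : R) :
    ∃ f : ℕ → R, f 0 = 1 ∧ ∀ j, D (f (j + 1)) =
      (1 / 4 : ℂ) • D (D (D (f j))) + q * D (f j) + (1 / 2 : ℂ) • (D q * f j) := by
  classical
  let S : (ℕ → R) → ℕ → R := fun h n => ∑ p ∈ Finset.HasAntidiagonal.antidiagonal n,
    ((1 / 2 : ℂ) • (h p.1 * D (D (h p.2))) - (1 / 4 : ℂ) • (D (h p.1) * D (h p.2))
      + q * (h p.1 * h p.2))
  let step : (n : ℕ) → ((m : ℕ) → m < n → R) → R := fun n g =>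
    let h : ℕ → R := fun m => if hm : m < n then g m hm else 0
    if n = 0 then 1 else
      (1 / 2 : ℂ) • (S h (n - 1) - ∑ p ∈ Finset.HasAntidiagonal.antidiagonal n, h p.1 * h p.2)
  let f : ℕ → R := fun n => WellFounded.fix Nat.lt_wfRel.wf step n
  have hf : ∀ n, f n = step n (fun m _ => f m) := fun n => WellFounded.fix_eq _ _ n
  have f0 : f 0 = 1 := by rw [hf]; simp [step]
  have hS : ∀ (n : ℕ), S (fun m => if m < n + 1 then f m else 0) n = S f n := by
    intro n
    refine Finset.sum_congr rfl fun p hp => ?_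
    have := Finset.HasAntidiagonal.mem_antidiagonal.1 hp
    simp only [show p.1 < n + 1 by omega, show p.2 < n + 1 by omega, if_true]
  have fs : ∀ n, ∑ p ∈ Finset.HasAntidiagonal.antidiagonal (n + 1), f p.1 * f p.2 = S f n := by
    intro n
    have h1 : ∀ p ∈ Finset.HasAntidiagonal.antidiagonal (n + 1), f p.1 * f p.2 =
        (if p.1 < n + 1 then f p.1 else 0) * (if p.2 < n + 1 then f p.2 else 0)
        + (if p = (0, n + 1) then f (n + 1) else 0)
        + (if p = (n + 1, 0) then f (n + 1) else 0) := by
      rintro ⟨a, b⟩ hp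
      have hp := Finset.HasAntidiagonal.mem_antidiagonal.1 hp
      simp only [Prod.mk.injEq] at hp ⊢
      rcases Nat.eq_zero_or_pos a with rfl | ha
      · obtain rfl : b = n + 1 := by omega
        simp [f0]
      rcases Nat.eq_zero_or_pos b with rfl | hb
      · obtain rfl : a = n + 1 := by omega
        simp [f0]
      · simp [show a < n + 1 by omega, show b < n + 1 by omega, ha.ne', hb.ne']
    rw [Finset.sum_congr rfl h1, Finset.sum_add_distrib, Finset.sum_add_distrib,
      Finset.sum_ite_eq', Finset.sum_ite_eq']
    have h2 := hf (n + 1)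
    simp only [step, Nat.add_eq_zero_iff, one_ne_zero, and_false, if_false, dite_eq_ite,
      Nat.add_sub_cancel, hS] at h2
    have h3 : (2 : ℂ) • f (n + 1) = S f n - ∑ p ∈ Finset.HasAntidiagonal.antidiagonal (n + 1),
        (if p.1 < n + 1 then f p.1 else 0) * (if p.2 < n + 1 then f p.2 else 0) := by
      rw [h2, smul_smul]; norm_num
    rw [two_smul] at h3
    simp only [Finset.HasAntidiagonal.mem_antidiagonal, zero_add, add_zero, if_true]
    linear_combination h3
  let F : PowerSeries R := PowerSeries.mk f
  let d : PowerSeries R → PowerSeries R := fun G =>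
    PowerSeries.mk fun n => D (PowerSeries.coeff n G)
  have dmul : ∀ G H, d (G * H) = G * d H + H * d G := by
    intro G H
    rw [mul_comm H]
    ext n
    simp only [d, PowerSeries.coeff_mk, PowerSeries.coeff_mul, map_sum, map_add,
      Derivation.leibniz, smul_eq_mul, ← Finset.sum_add_distrib]
    exact Finset.sum_congr rfl fun p _ => by ring
  have dadd : ∀ G H, d (G + H) = d G + d H := by
    intro G H; ext n; simp [d]
  have dsub : ∀ G H, d (G - H) = d G - d H := by
    intro G H; ext n; simp [d]
  have dsmul : ∀ (c : ℂ) G, d (c • G) = c • d G := by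
    intro c G; ext n
    simp [d]
  have dX : d PowerSeries.X = 0 := by
    ext n; simp only [d, PowerSeries.coeff_mk, PowerSeries.coeff_X]; split_ifs <;> simp
  have key : F * F = 1 + PowerSeries.X * ((1 / 2 : ℂ) • (F * d (d F)) - (1 / 4 : ℂ) • (d F * d F)
      + PowerSeries.C q * (F * F)) := by
    ext n
    rcases n with _ | n
    · simp [F, f0]
    · simp only [map_add, PowerSeries.coeff_succ_X_mul, map_sub,
        PowerSeries.coeff_C_mul, PowerSeries.coeff_one, PowerSeries.coeff_smul]
      simp only [F, d, PowerSeries.coeff_mul, PowerSeries.coeff_mk, fs]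
      simp only [S, Finset.sum_add_distrib, Finset.sum_sub_distrib, Finset.smul_sum,
        Finset.mul_sum]
      simp
  have d1 : d 1 = 0 := by
    ext n; simp only [d, PowerSeries.coeff_mk, PowerSeries.coeff_one]; split_ifs <;> simp
  have key2 := congrArg d key
  simp only [dadd, dsub, dsmul, dmul, dX, d1] at key2
  have hu : IsUnit F := by
    rw [PowerSeries.isUnit_iff_constantCoeff]; simp [F, f0]
  have key3 : (2 : ℂ) • d F = PowerSeries.X * ((1 / 2 : ℂ) • d (d (d F))
      + (2 : ℂ) • (PowerSeries.C q * d F) + d (PowerSeries.C q) * F) := by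
    refine hu.mul_left_cancel ?_
    simp only [Algebra.smul_def] at key2 ⊢
    have e1 : algebraMap ℂ (PowerSeries R) (1 / 4) * 2 = algebraMap ℂ (PowerSeries R) (1 / 2) := by
      rw [← map_ofNat (algebraMap ℂ (PowerSeries R)) 2, ← map_mul]; norm_num
    rw [map_ofNat]
    linear_combination key2 + (- PowerSeries.X * (d F) * d (d F)) * e1
  refine ⟨f, f0, fun j => ?_⟩
  have := congrArg (fun G => (1 / 2 : ℂ) • PowerSeries.coeff (j + 1) G) key3
  have dC : d (PowerSeries.C q) = PowerSeries.C (D q) := by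
    ext n; simp only [d, PowerSeries.coeff_mk, PowerSeries.coeff_C]; split_ifs <;> simp
  simp only [PowerSeries.coeff_succ_X_mul, map_add, PowerSeries.coeff_C_mul, dC,
    PowerSeries.coeff_smul] at this
  simp only [F, d, PowerSeries.coeff_mk, smul_add, smul_smul] at this
  norm_num at this
  rw [this]

/-- Every holomorphic function on an open set has KdV recursion coefficients, namely suitable
differential polynomials in it; so `IsKdVRecursion` is always satisfiable. -/
theorem IsKdVRecursion.exists_of_differentiableOn {U : Set ℂ} (hU : IsOpen U) {q : ℂ → ℂ}
    (hq : DifferentiableOn ℂ q U) : ∃ f : ℕ → ℂ → ℂ, IsKdVRecursion U q f := by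
  let D : Derivation ℂ (MvPolynomial ℕ ℂ) (MvPolynomial ℕ ℂ) :=
    MvPolynomial.mkDerivation ℂ fun n => MvPolynomial.X (n + 1)
  let E : MvPolynomial ℕ ℂ → ℂ → ℂ := fun p z =>
    MvPolynomial.aeval (fun n => iteratedDeriv n q z) p
  have hE : ∀ p, ∀ z ∈ U, HasDerivAt (E p) (E (D p) z) z := by
    intro p z hz
    induction p using MvPolynomial.induction_on with
    | C a =>
      simpa [E, D] using hasDerivAt_const z a
    | add p r hp hr =>
      have := hp.add hr
      simpa [E, Pi.add_def] using this
    | mul_X p n hp =>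
      have h1 : HasDerivAt (iteratedDeriv n q) (iteratedDeriv (n + 1) q z) z := by
        rw [iteratedDeriv_succ]
        have := ((hq.analyticOnNhd hU) z hz).iterated_deriv n
        rw [← iteratedDeriv_eq_iterate] at this
        exact this.differentiableAt.hasDerivAt
      have := hp.mul h1
      simpa [E, D, Pi.mul_def, MvPolynomial.mkDerivation_X, add_comm, mul_comm] using this
  obtain ⟨p, p0, hp⟩ := exists_kdvRecursion_of_derivation D (MvPolynomial.X 0)
  have hd : ∀ r, ∀ z ∈ U, deriv (E r) z = E (D r) z := fun r z hz => (hE r z hz).deriv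
  have hd2 : ∀ (r s : ℂ → ℂ), (∀ z ∈ U, r z = s z) → ∀ z ∈ U, deriv r z = deriv s z :=
    fun r s h z hz => Filter.EventuallyEq.deriv_eq (Filter.eventually_of_mem (hU.mem_nhds hz) h)
  refine ⟨fun j => E (p j), fun j z hz => (hE _ z hz).differentiableAt.differentiableWithinAt,
    fun z _ => by simp [E, p0], fun j z hz => ?_⟩
  have h3 : iteratedDeriv 3 (E (p j)) z = E (D (D (D (p j)))) z := by
    simp only [iteratedDeriv_succ, iteratedDeriv_zero]
    rw [hd2 _ _ (hd2 _ _ (hd (p j))) z hz, hd2 _ _ (hd (D (p j))) z hz, hd _ z hz]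
  rw [h3, hd _ z hz, hd _ z hz, hp]
  simp [E, D, MvPolynomial.mkDerivation_X]
  ring

/-! Locally, at `ζ l` with `s = s l`, one has `q = -s(s+1)x⁻² + e`, and the locus conditions say
that the odd Taylor coefficients of `e` vanish up to order `2s-1`. The recursion sends `x^(-2k)` to
`(2k+1)(s(s+1) - k(k+1)) x^(-2k-3)` plus lower poles of odd order. The factor vanishes at `k = s`,
so pole orders stop growing there (`kdvOperator_mem_laurentGerms`). As `f (j+1)` is single-valued,
the residue of its derivative is zero, and integration gives even exponents at most `2 min(j+1, s)`
(`mem_laurentGerms_of_deriv_mem`). Such a principal part is matched by powers of the even function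
`𝒫` (`exists_sub_sum_pow_mem_laurentGerms`).

Globally, the difference of `f j` and these powers has only removable singularities, and Liouville's
theorem should make it constant. This needs periodicity and boundedness, which are not given for `f
j`. However, `exists_kdvRecursion_of_derivation` yields coefficients that are differential
polynomials in `q` and so inherit both properties from `𝒫` (`IsTame`). Since the regular set is
connected, `f j` is a constant-coefficient combination of them (`IsKdVRecursion.exists_eq_sum`). -/

open Filter Topology

/-! ### Germs with prescribed pole orders -/

/-- The functions which, on a punctured neighbourhood of `0`, are the sum of an analytic function
and a linear combination of the `x ^ (-n)` with `n ∈ S`. -/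
def laurentGerms (S : Finset ℕ) : Submodule ℂ (ℂ → ℂ) where
  carrier := {f | ∃ (c : ℕ → ℂ) (h : ℂ → ℂ), AnalyticAt ℂ h 0 ∧
    f =ᶠ[𝓝[≠] 0] fun x => ∑ n ∈ S, c n * (x ^ n)⁻¹ + h x}
  add_mem' := by
    rintro f g ⟨c, h, hh, hf⟩ ⟨c', h', hh', hg⟩
    refine ⟨c + c', h + h', hh.add hh', ?_⟩
    filter_upwards [hf, hg] with x hx hx'
    simp only [Pi.add_apply, hx, hx', add_mul, Finset.sum_add_distrib]
    ring
  zero_mem' := ⟨0, 0, analyticAt_const, Eventually.of_forall fun x => by simp⟩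
  smul_mem' := by
    rintro a f ⟨c, h, hh, hf⟩
    refine ⟨a • c, a • h, hh.const_smul, ?_⟩
    filter_upwards [hf] with x hx
    simp [hx, mul_add, Finset.mul_sum, mul_assoc]

theorem mem_laurentGerms_congr {S : Finset ℕ} {f g : ℂ → ℂ} (hfg : f =ᶠ[𝓝[≠] 0] g)
    (hg : g ∈ laurentGerms S) : f ∈ laurentGerms S := by
  obtain ⟨c, h, hh, hg⟩ := hg
  exact ⟨c, h, hh, hfg.trans hg⟩

theorem mem_laurentGerms_of_analyticAt {S : Finset ℕ} {f : ℂ → ℂ} (hf : AnalyticAt ℂ f 0) :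
    f ∈ laurentGerms S :=
  ⟨0, f, hf, by simp⟩

theorem inv_pow_mem_laurentGerms {S : Finset ℕ} {n : ℕ} (hn : n ∈ S) :
    (fun x : ℂ => (x ^ n)⁻¹) ∈ laurentGerms S := by
  refine ⟨Pi.single n 1, 0, analyticAt_const, Eventually.of_forall fun x => ?_⟩
  simp only [Pi.zero_apply, add_zero]
  rw [Finset.sum_eq_single_of_mem n hn fun m _ hm => by simp [hm]]
  simp

theorem mul_mem_laurentGerms {S : Finset ℕ} {f : ℂ → ℂ} (hf : f ∈ laurentGerms S) (a : ℂ) :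
    (fun x => a * f x) ∈ laurentGerms S :=
  (laurentGerms S).smul_mem a hf

theorem add_mem_laurentGerms {S : Finset ℕ} {f g : ℂ → ℂ} (hf : f ∈ laurentGerms S)
    (hg : g ∈ laurentGerms S) : (fun x => f x + g x) ∈ laurentGerms S :=
  (laurentGerms S).add_mem hf hg

theorem sum_mem_laurentGerms {ι : Type*} {S : Finset ℕ} {f : ι → ℂ → ℂ} {t : Finset ι}
    (hf : ∀ i ∈ t, f i ∈ laurentGerms S) : (fun x => ∑ i ∈ t, f i x) ∈ laurentGerms S := by
  have := (laurentGerms S).sum_mem hf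
  convert this using 1
  ext x
  simp

theorem AnalyticAt.exists_eventuallyEq_taylor {e : ℂ → ℂ} (he : AnalyticAt ℂ e 0) (N : ℕ) :
    ∃ g, AnalyticAt ℂ g 0 ∧ ∀ᶠ x in 𝓝 0,
      e x = ∑ i ∈ Finset.range N, iteratedDeriv i e 0 / i.factorial * x ^ i + x ^ N * g x := by
  have han : AnalyticAt ℂ
      (fun x => ∑ i ∈ Finset.range N, iteratedDeriv i e 0 / i.factorial * x ^ i) 0 := by
    fun_prop
  have h := (natCast_le_analyticOrderAt_iff_iteratedDeriv_eq_zero (n := N) (he.fun_sub han)).2 ?_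
  · obtain ⟨g, hg, hg'⟩ := (natCast_le_analyticOrderAt (he.fun_sub han)).1 h
    refine ⟨g, hg, ?_⟩
    filter_upwards [hg'] with x hx
    simp only [sub_zero, smul_eq_mul] at hx
    linear_combination hx
  · intro n hn
    rw [iteratedDeriv_fun_sub he.contDiffAt han.contDiffAt,
      iteratedDeriv_fun_sum fun i _ => by fun_prop]
    simp only [iteratedDeriv_const_mul_field, iteratedDeriv_fun_pow_zero]
    rw [Finset.sum_eq_single_of_mem n (Finset.mem_range.2 hn) fun m _ hm => by simp [hm.symm]]
    have := Nat.factorial_ne_zero n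
    simp
    field_simp
    simp

/-- The Taylor term of order `i < N` contributes a pole of order `N - i`, so it must either vanish
or have an admissible exponent. This turns parity of Taylor coefficients into parity of principal
parts. -/
theorem inv_pow_mul_mem_laurentGerms {S : Finset ℕ} {e : ℂ → ℂ} (he : AnalyticAt ℂ e 0) (N : ℕ)
    (h : ∀ i < N, iteratedDeriv i e 0 = 0 ∨ N - i ∈ S) :
    (fun x => (x ^ N)⁻¹ * e x) ∈ laurentGerms S := by
  obtain ⟨g, hg, hg'⟩ := he.exists_eventuallyEq_taylor N
  refine mem_laurentGerms_congr (g := fun x => ∑ i ∈ Finset.range N,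
    iteratedDeriv i e 0 / i.factorial * (x ^ (N - i))⁻¹ + g x) ?_
    (add_mem_laurentGerms (sum_mem_laurentGerms fun i hi => ?_) (mem_laurentGerms_of_analyticAt hg))
  · filter_upwards [self_mem_nhdsWithin, hg'.filter_mono nhdsWithin_le_nhds] with x hx hx'
    have hx0 : x ≠ 0 := hx
    rw [hx', mul_add, inv_mul_cancel_left₀ (pow_ne_zero _ hx0), Finset.mul_sum]
    congr 1
    refine Finset.sum_congr rfl fun i hi => ?_
    have : x ^ N = x ^ (N - i) * x ^ i := by
      rw [← pow_add, Nat.sub_add_cancel (Finset.mem_range.1 hi).le]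
    rw [this]
    field_simp
  · rcases h i (Finset.mem_range.1 hi) with h0 | h0
    · simpa only [h0, zero_div, zero_mul] using
        mem_laurentGerms_of_analyticAt (f := fun _ => 0) analyticAt_const
    · exact mul_mem_laurentGerms (inv_pow_mem_laurentGerms h0) _

theorem iteratedDeriv_odd_eq_zero_of_even {e : ℂ → ℂ} (he : ∀ x, e (-x) = e x) {n : ℕ}
    (hn : Odd n) : iteratedDeriv n e 0 = 0 := by
  have h := iteratedDeriv_comp_neg n e 0
  simp only [he, neg_zero, hn.neg_one_pow] at h
  simpa [CharZero.eq_neg_self_iff] using h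

/-- The exponents `2, 4, …, 2m`. -/
def evenExponents (m : ℕ) : Finset ℕ := (Finset.Icc 1 m).image (2 * ·)

/-- The exponents `1, 3, …, 2m + 1`. -/
def oddExponents (m : ℕ) : Finset ℕ := (Finset.range (m + 1)).image (2 * · + 1)

theorem mem_evenExponents {m n : ℕ} : n ∈ evenExponents m ↔ Even n ∧ 1 ≤ n ∧ n ≤ 2 * m := by
  simp only [evenExponents, Finset.mem_image, Finset.mem_Icc]
  exact ⟨by rintro ⟨k, hk, rfl⟩; exact ⟨by simp, by omega⟩,
    fun ⟨⟨k, hk⟩, h⟩ => ⟨k, by omega, by omega⟩⟩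

theorem mem_oddExponents {m n : ℕ} : n ∈ oddExponents m ↔ Odd n ∧ n ≤ 2 * m + 1 := by
  simp only [oddExponents, Finset.mem_image, Finset.mem_range]
  exact ⟨by rintro ⟨k, hk, rfl⟩; exact ⟨by simp, by omega⟩,
    fun ⟨⟨k, hk⟩, h⟩ => ⟨k, by omega, by omega⟩⟩

theorem mem_laurentGerms_evenExponents {m : ℕ} {f : ℂ → ℂ} :
    f ∈ laurentGerms (evenExponents m) ↔ ∃ (c : ℕ → ℂ) (h : ℂ → ℂ), AnalyticAt ℂ h 0 ∧
      f =ᶠ[𝓝[≠] 0] fun x => ∑ k ∈ Finset.Icc 1 m, c k * (x ^ (2 * k))⁻¹ + h x := by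
  have key (c : ℕ → ℂ) (x : ℂ) : ∑ n ∈ evenExponents m, c n * (x ^ n)⁻¹ =
      ∑ k ∈ Finset.Icc 1 m, c (2 * k) * (x ^ (2 * k))⁻¹ :=
    Finset.sum_image fun a _ b _ hab => by simpa using hab
  constructor
  · rintro ⟨c, h, hh, hf⟩
    exact ⟨fun k => c (2 * k), h, hh, by simpa only [key] using hf⟩
  · rintro ⟨c, h, hh, hf⟩
    refine ⟨fun k => c (k / 2), h, hh, ?_⟩
    simpa only [key, Nat.mul_div_cancel_left _ (two_pos : 0 < 2)] using hf

theorem mem_laurentGerms_oddExponents {m : ℕ} {f : ℂ → ℂ} (hf : f ∈ laurentGerms (oddExponents m)) :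
    ∃ (c : ℕ → ℂ) (h : ℂ → ℂ), AnalyticAt ℂ h 0 ∧
      f =ᶠ[𝓝[≠] 0] fun x => c 0 * x⁻¹ + ∑ k ∈ Finset.Icc 1 m, c k * (x ^ (2 * k + 1))⁻¹ + h x := by
  obtain ⟨c, h, hh, hf⟩ := hf
  refine ⟨fun k => c (2 * k + 1), h, hh, hf.trans (Eventually.of_forall fun x => ?_)⟩
  have : ∑ n ∈ oddExponents m, c n * (x ^ n)⁻¹ =
      ∑ k ∈ Finset.range (m + 1), c (2 * k + 1) * (x ^ (2 * k + 1))⁻¹ :=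
    Finset.sum_image fun a _ b _ hab => by simpa using hab
  simp only [this]
  rw [Finset.range_eq_Ico, Finset.sum_eq_sum_Ico_succ_bot (Nat.succ_pos m)]
  simp
  rfl

theorem hasDerivAt_inv_pow (n : ℕ) {x : ℂ} (hx : x ≠ 0) :
    HasDerivAt (fun x : ℂ => (x ^ n)⁻¹) (-n * (x ^ (n + 1))⁻¹) x := by
  have := hasDerivAt_zpow (-n : ℤ) x (Or.inl hx)
  simp only [zpow_neg, zpow_natCast] at this
  refine this.congr_deriv ?_
  rw [show (-(n : ℤ) - 1) = -((n + 1 : ℕ) : ℤ) by push_cast; ring, zpow_neg, zpow_natCast]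
  simp

/-- The exponents `e k` are left general so that the lemma can be iterated up to the third
derivative, and also applied to the potential with a single term. -/
theorem deriv_eventuallyEq_of_laurent {ι : Type*} {t : Finset ι} {c : ι → ℂ} {e : ι → ℕ}
    {f h : ℂ → ℂ} (hh : AnalyticAt ℂ h 0)
    (hf : f =ᶠ[𝓝[≠] 0] fun x => ∑ k ∈ t, c k * (x ^ e k)⁻¹ + h x) :
    deriv f =ᶠ[𝓝[≠] 0] fun x => ∑ k ∈ t, -e k * c k * (x ^ (e k + 1))⁻¹ + deriv h x := by
  refine hf.nhdsNE_deriv.trans ?_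
  filter_upwards [self_mem_nhdsWithin,
    hh.eventually_analyticAt.filter_mono nhdsWithin_le_nhds] with x hx hx'
  refine HasDerivAt.deriv (HasDerivAt.add ?_ hx'.differentiableAt.hasDerivAt)
  refine HasDerivAt.fun_sum fun k _ => ?_
  exact ((hasDerivAt_inv_pow (e k) hx).const_mul (c k)).congr_deriv (by ring)

/-! ### The KdV operator at a pole -/

/-- The right-hand side of the KdV recursion. -/
noncomputable def kdvOperator (q f : ℂ → ℂ) (z : ℂ) : ℂ :=
  1 / 4 * iteratedDeriv 3 f z + q z * deriv f z + 1 / 2 * deriv q z * f z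

/-- The leading exponents of `kdvOperator q` at a pole of `q` of the form `-s (s + 1) x ^ (-2)`
stop at `2 * s + 1`, and the parity of the principal part is preserved when the odd derivatives
of the regular part of `q` vanish up to the order `2 * s - 1`. -/
theorem kdvOperator_mem_laurentGerms {q e f : ℂ → ℂ} {s m : ℕ} (hs : 1 ≤ s) (hm : m ≤ s)
    (he : AnalyticAt ℂ e 0)
    (hq : q =ᶠ[𝓝[≠] 0] fun x => -(s * (s + 1)) * (x ^ 2)⁻¹ + e x)
    (hodd : ∀ k, 1 ≤ k → k ≤ s → iteratedDeriv (2 * k - 1) e 0 = 0)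
    (hf : f ∈ laurentGerms (evenExponents m)) :
    kdvOperator q f ∈ laurentGerms (oddExponents (min (m + 1) s)) := by
  obtain ⟨c, h, hh, hf⟩ := mem_laurentGerms_evenExponents.1 hf
  have hodd' (i : ℕ) (hi : Odd i) (his : i < 2 * s) : iteratedDeriv i e 0 = 0 := by
    obtain ⟨k, rfl⟩ := hi
    exact hodd (k + 1) (by omega) (by omega)
  have hf1 := deriv_eventuallyEq_of_laurent hh hf
  have hf2 := deriv_eventuallyEq_of_laurent hh.deriv hf1
  have hf3 := deriv_eventuallyEq_of_laurent hh.deriv.deriv hf2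
  have hq1 : deriv q =ᶠ[𝓝[≠] 0] _ := deriv_eventuallyEq_of_laurent (t := {()})
    (c := fun _ => -(s * (s + 1) : ℂ)) (e := fun _ => 2) he (by simpa using hq)
  simp only [Finset.sum_singleton] at hq1
  -- The regular part `h` of `f` meets the double pole of `q` in `s(s+1)(x⁻³ h - x⁻² h') = s(s+1)
  -- x⁻³ w`.
  let w : ℂ → ℂ := fun x => h x - x * deriv h x
  have hw : AnalyticAt ℂ w 0 := hh.sub (analyticAt_id.mul hh.deriv)
  refine mem_laurentGerms_congr (g := fun x => ∑ k ∈ Finset.Icc 1 m,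
      ((2 * k + 1) * (s * (s + 1) - k * (k + 1)) * c k * (x ^ (2 * k + 3))⁻¹ +
        (-(2 * k) * c k * ((x ^ (2 * k + 1))⁻¹ * e x) +
        1 / 2 * c k * ((x ^ (2 * k))⁻¹ * deriv e x))) + (s * (s + 1) * ((x ^ 3)⁻¹ * w x) +
      (1 / 4 * deriv (deriv (deriv h)) x + e x * deriv h x + 1 / 2 * deriv e x * h x))) ?_ ?_
  · filter_upwards [self_mem_nhdsWithin, hf, hf1, hf3, hq, hq1] with x hx h0 h1 h3 hq0 hq1
    have hx0 : x ≠ 0 := hx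
    simp only [kdvOperator, iteratedDeriv_succ, iteratedDeriv_zero, h0, h1, h3, hq0, hq1, w]
    have key (k : ℕ) : (2 * k + 1) * (s * (s + 1) - k * (k + 1)) * c k * (x ^ (2 * k + 3))⁻¹ +
        (-(2 * k) * c k * ((x ^ (2 * k + 1))⁻¹ * e x) +
        1 / 2 * c k * ((x ^ (2 * k))⁻¹ * deriv e x)) =
        1 / 4 * (-((2 * k + 1 + 1 : ℕ) : ℂ) * (-((2 * k + 1 : ℕ) : ℂ) * (-((2 * k : ℕ) : ℂ) * c k)) *
          (x ^ (2 * k + 1 + 1 + 1))⁻¹) +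
        (-(s * (s + 1)) * (x ^ 2)⁻¹ + e x) *
          (-((2 * k : ℕ) : ℂ) * c k * (x ^ (2 * k + 1))⁻¹) +
        1 / 2 * (-((2 : ℕ) : ℂ) * -(s * (s + 1)) * (x ^ (2 + 1))⁻¹ + deriv e x) *
          (c k * (x ^ (2 * k))⁻¹) := by
      push_cast
      field_simp
      ring
    simp only [key, Finset.sum_add_distrib, ← Finset.mul_sum]
    push_cast
    field_simp
    ring
  refine add_mem_laurentGerms (sum_mem_laurentGerms fun k hk => add_mem_laurentGerms ?_
    (add_mem_laurentGerms (mul_mem_laurentGerms ?_ _) (mul_mem_laurentGerms ?_ _)))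
    (add_mem_laurentGerms (mul_mem_laurentGerms ?_ _) (mem_laurentGerms_of_analyticAt ?_))
  · have := Finset.mem_Icc.1 hk
    -- For `k = s` the exponent `2s + 3` would be too large, but its coefficient vanishes.
    rcases eq_or_ne k s with rfl | hks
    · simpa only [sub_self, mul_zero, zero_mul] using
        mem_laurentGerms_of_analyticAt (f := fun _ => 0) analyticAt_const
    · exact mul_mem_laurentGerms (inv_pow_mem_laurentGerms
        (mem_oddExponents.2 ⟨⟨k + 1, by ring⟩, by omega⟩)) _
  · have := Finset.mem_Icc.1 hk
    -- Even `i` gives the odd exponent `2k + 1 - i`; odd `i` satisfies `i ≤ 2k - 1 ≤ 2s - 1`,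
    -- exactly the range of the locus conditions.
    refine inv_pow_mul_mem_laurentGerms he _ fun i hi => ?_
    rcases Nat.even_or_odd i with ⟨j, rfl⟩ | hi'
    · exact Or.inr (mem_oddExponents.2 ⟨⟨k - j, by omega⟩, by omega⟩)
    · obtain ⟨j, rfl⟩ := hi'
      exact Or.inl (hodd' _ ⟨j, rfl⟩ (by omega))
  · have := Finset.mem_Icc.1 hk
    refine inv_pow_mul_mem_laurentGerms he.deriv _ fun i hi => ?_
    rw [← iteratedDeriv_succ']
    rcases Nat.even_or_odd i with ⟨j, rfl⟩ | hi'
    · exact Or.inl (hodd' _ ⟨j, by ring⟩ (by omega))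
    · obtain ⟨j, rfl⟩ := hi'
      exact Or.inr (mem_oddExponents.2 ⟨⟨k - j - 1, by omega⟩, by omega⟩)
  · refine inv_pow_mul_mem_laurentGerms hw _ fun i hi => ?_
    interval_cases i
    · exact Or.inr (mem_oddExponents.2 ⟨⟨1, rfl⟩, by omega⟩)
    -- The exponent `2` is absent because `w' = -x h''` vanishes at `0`.
    · left
      have h1 : HasDerivAt w _ 0 := hh.differentiableAt.hasDerivAt.sub
        ((hasDerivAt_id (0 : ℂ)).mul hh.deriv.differentiableAt.hasDerivAt)
      simpa using h1.deriv
    · exact Or.inr (mem_oddExponents.2 ⟨⟨0, rfl⟩, by omega⟩)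
  · have := he.deriv
    have := hh.deriv
    have := hh.deriv.deriv.deriv
    fun_prop

/-! ### Integration and reduction to powers of an even function -/

/-- The punctured ball is the image of the connected punctured plane under the radial contraction `x
↦ r x / (1 + ‖x‖)`. -/
theorem isPreconnected_ball_sdiff_zero (r : ℝ) :
    IsPreconnected (Metric.ball (0 : ℂ) r \ {0}) := by
  rcases le_or_gt r 0 with hr | hr
  · simp [Metric.ball_eq_empty.2 hr, isPreconnected_empty]
  have h : IsPreconnected ({0}ᶜ : Set ℂ) :=
    (isConnected_compl_singleton_of_one_lt_rank (by simp) 0).isPreconnected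
  have hpos (x : ℂ) : 0 < 1 + ‖x‖ := by positivity
  convert h.image (fun x : ℂ => (r / (1 + ‖x‖)) • x) (Continuous.continuousOn (by
    fun_prop (disch := exact fun x => (hpos x).ne')))
  ext y
  simp only [Set.mem_sdiff, mem_ball_zero_iff, Set.mem_singleton_iff, Set.mem_image,
    Set.mem_compl_iff]
  constructor
  · rintro ⟨hy, hy0⟩
    have h1 : 0 < r - ‖y‖ := by linarith
    refine ⟨(r - ‖y‖)⁻¹ • y, smul_ne_zero (inv_ne_zero h1.ne') hy0, ?_⟩
    rw [norm_smul, norm_inv, Real.norm_of_nonneg h1.le, smul_smul]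
    convert one_smul ℝ y
    field_simp
    ring
  · rintro ⟨x, hx, rfl⟩
    refine ⟨?_, smul_ne_zero (div_ne_zero hr.ne' (hpos x).ne') hx⟩
    rw [norm_smul, Real.norm_of_nonneg (by positivity), div_mul_eq_mul_div,
      div_lt_iff₀ (hpos x)]
    nlinarith

/-- Termwise integration: the residue of the derivative vanishes. -/
theorem mem_laurentGerms_of_deriv_mem {m : ℕ} {F : ℂ → ℂ}
    (hF : ∀ᶠ x in 𝓝[≠] 0, DifferentiableAt ℂ F x)
    (hF' : deriv F ∈ laurentGerms (oddExponents m)) :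
    F ∈ laurentGerms (evenExponents m) := by
  obtain ⟨c, h, hh, hF'⟩ := mem_laurentGerms_oddExponents hF'
  have hev := hF.and (hF'.and (hh.eventually_analyticAt.filter_mono nhdsWithin_le_nhds))
  rw [eventually_nhdsWithin_iff] at hev
  obtain ⟨r, hr, hball⟩ := Metric.eventually_nhds_iff_ball.1
    (hev.and (hh.eventually_analyticAt))
  obtain ⟨H, hH⟩ := DifferentiableOn.isExactOn_ball (c := 0) (r := r) (f := h)
    fun x hx => (hball x hx).2.differentiableAt.differentiableWithinAt
  let G : ℂ → ℂ := fun x =>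
    F x - (∑ k ∈ Finset.Icc 1 m, -c k / (2 * k) * (x ^ (2 * k))⁻¹ + H x)
  have hG : ∀ x ∈ Metric.ball (0 : ℂ) r \ {0}, HasDerivAt G (c 0 * x⁻¹) x := by
    rintro x ⟨hx, hx0⟩
    have hx0' : x ≠ 0 := hx0
    obtain ⟨h1, h2, -⟩ := (hball x hx).1 hx0
    have h3 := h1.hasDerivAt
    rw [h2] at h3
    have h4 := h3.sub ((HasDerivAt.fun_sum fun k (_ : k ∈ Finset.Icc 1 m) =>
      (hasDerivAt_inv_pow (2 * k) hx0').const_mul (-c k / (2 * k))).add (hH x hx))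
    refine h4.congr_deriv ?_
    have : ∑ k ∈ Finset.Icc 1 m, -c k / (2 * k) * (-((2 * k : ℕ) : ℂ) * (x ^ (2 * k + 1))⁻¹) =
        ∑ k ∈ Finset.Icc 1 m, c k * (x ^ (2 * k + 1))⁻¹ := by
      refine Finset.sum_congr rfl fun k hk => ?_
      have : (k : ℂ) ≠ 0 := by
        have := (Finset.mem_Icc.1 hk).1
        exact_mod_cast (by omega : k ≠ 0)
      push_cast
      field_simp
    rw [this]
    ring
  -- `G` is a single-valued primitive of `c 0 / x` on the punctured ball, so the circle integral
  -- `2πi c 0` is zero.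
  have hc0 : c 0 = 0 := by
    have hr2 : (0 : ℝ) < r / 2 := by positivity
    have := circleIntegral.integral_eq_zero_of_hasDerivWithinAt (f := G)
      (f' := fun x => c 0 * (x - 0)⁻¹) (c := 0) hr2.le fun x hx => by
        have hn : ‖x‖ = r / 2 := by simpa using hx
        rw [sub_zero]
        refine (hG x ⟨by simp [hn, hr], ?_⟩).hasDerivWithinAt
        rintro rfl
        simp at hn
        linarith
    rw [circleIntegral.integral_const_mul, circleIntegral.integral_sub_center_inv _ hr2.ne'] at this
    simpa [Real.pi_ne_zero] using this
  obtain ⟨a, ha⟩ := IsOpen.exists_is_const_of_deriv_eq_zero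
    (Metric.isOpen_ball.sdiff isClosed_singleton) (isPreconnected_ball_sdiff_zero r)
    (fun x hx => (hG x hx).differentiableAt.differentiableWithinAt)
    (fun x hx => by simp [(hG x hx).deriv, hc0])
  refine mem_laurentGerms_evenExponents.2 ⟨fun k => -c k / (2 * k), fun x => H x + a, ?_, ?_⟩
  · have : DifferentiableOn ℂ H (Metric.ball 0 r) :=
      fun x hx => (hH x hx).differentiableAt.differentiableWithinAt
    exact (this.analyticAt (Metric.ball_mem_nhds 0 hr)).add analyticAt_const
  · filter_upwards [self_mem_nhdsWithin, nhdsWithin_le_nhds (Metric.ball_mem_nhds (0 : ℂ) hr)]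
      with x hx hx'
    have := ha x ⟨hx', hx⟩
    simp only [G] at this
    linear_combination this

/-- Even principal parts of order at most `2 * m` are, up to regular germs, linear combinations of
powers of an even function with principal part `x ^ (-2)`. -/
theorem exists_sub_sum_pow_mem_laurentGerms {P u : ℂ → ℂ} (hu : AnalyticAt ℂ u 0)
    (hu_even : ∀ x, u (-x) = u x) (hP : P =ᶠ[𝓝[≠] 0] fun x => (x ^ 2)⁻¹ + u x)
    (m : ℕ) {f : ℂ → ℂ} (hf : f ∈ laurentGerms (evenExponents m)) :
    ∃ a : ℕ → ℂ, (fun x => f x - ∑ k ∈ Finset.Icc 1 m, a k * P x ^ k) ∈ laurentGerms ∅ := by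
  induction m generalizing f with
  | zero => exact ⟨0, by simpa [evenExponents] using hf⟩
  | succ m ih =>
    obtain ⟨c, h, hh, hf⟩ := mem_laurentGerms_evenExponents.1 hf
    -- `P^(m+1) = x^(-2(m+1)) (1 + v)` with `v` even and `v 0 = 0`, so subtracting the right
    -- multiple of it leaves even exponents at most `2m`.
    let v : ℂ → ℂ := fun x => (1 + x ^ 2 * u x) ^ (m + 1) - 1
    have hv : AnalyticAt ℂ v 0 := by fun_prop
    have hv_even : ∀ x, v (-x) = v x := fun x => by simp [v, hu_even]
    have hf' : (fun x => f x - c (m + 1) * P x ^ (m + 1)) ∈ laurentGerms (evenExponents m) := by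
      refine mem_laurentGerms_congr (g := fun x => ∑ k ∈ Finset.Icc 1 m, c k * (x ^ (2 * k))⁻¹ +
        (-c (m + 1) * ((x ^ (2 * (m + 1)))⁻¹ * v x) + h x)) ?_
        (add_mem_laurentGerms (sum_mem_laurentGerms fun k hk => ?_)
        (add_mem_laurentGerms (mul_mem_laurentGerms ?_ _) (mem_laurentGerms_of_analyticAt hh)))
      · filter_upwards [self_mem_nhdsWithin, hf, hP] with x hx h1 h2
        have hx0 : x ≠ 0 := hx
        rw [h1, h2, Finset.sum_Icc_succ_top (by omega)]
        have : (x ^ 2)⁻¹ + u x = (x ^ 2)⁻¹ * (1 + x ^ 2 * u x) := by field_simp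
        rw [this, mul_pow, inv_pow, ← pow_mul]
        simp only [v]
        ring
      · have := Finset.mem_Icc.1 hk
        exact mul_mem_laurentGerms (inv_pow_mem_laurentGerms
          (mem_evenExponents.2 ⟨by simp, by omega, by omega⟩)) _
      · refine inv_pow_mul_mem_laurentGerms hv _ fun i hi => ?_
        rcases Nat.even_or_odd i with hi' | hi'
        · rcases Nat.eq_zero_or_pos i with rfl | hpos
          · left
            simp [v]
          · right
            obtain ⟨j, rfl⟩ := hi'
            exact mem_evenExponents.2 ⟨⟨m + 1 - j, by omega⟩, by omega, by omega⟩
        · exact Or.inl (iteratedDeriv_odd_eq_zero_of_even hv_even hi')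
    obtain ⟨a, ha⟩ := ih hf'
    refine ⟨Function.update a (m + 1) (c (m + 1)), ?_⟩
    convert ha using 1
    ext x
    rw [Finset.sum_Icc_succ_top (by omega), Function.update_self, Finset.sum_congr rfl
      fun k hk => by rw [Function.update_of_ne (by have := Finset.mem_Icc.1 hk; omega)]]
    ring

/-! ### Periodic functions bounded away from their singularities -/

/-- A function that is periodic with respect to `Λ`, and differentiable and bounded off the
translates of a compact set. -/
structure IsTame (Λ : AddSubgroup ℂ) (g : ℂ → ℂ) : Prop where
  add_period : ∀ z, ∀ p ∈ Λ, g (z + p) = g z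
  bounded : ∃ K, IsCompact K ∧ ∃ B : ℝ, ∀ z, (∀ p ∈ Λ, z - p ∉ K) →
    DifferentiableAt ℂ g z ∧ ‖g z‖ ≤ B

namespace IsTame

variable {Λ : AddSubgroup ℂ} {f g : ℂ → ℂ}

theorem const (Λ : AddSubgroup ℂ) (c : ℂ) : IsTame Λ fun _ => c :=
  ⟨fun _ _ _ => rfl, ∅, isCompact_empty, ‖c‖, fun _ _ => ⟨differentiableAt_const c, le_rfl⟩⟩

theorem add (hf : IsTame Λ f) (hg : IsTame Λ g) : IsTame Λ fun z => f z + g z := by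
  obtain ⟨K, hK, B, h⟩ := hf.bounded
  obtain ⟨K', hK', B', h'⟩ := hg.bounded
  refine ⟨fun z p hp => by simp only [hf.add_period z p hp, hg.add_period z p hp],
    K ∪ K', hK.union hK', B + B', fun z hz => ?_⟩
  obtain ⟨h1, h2⟩ := h z fun p hp hm => hz p hp (Or.inl hm)
  obtain ⟨h1', h2'⟩ := h' z fun p hp hm => hz p hp (Or.inr hm)
  exact ⟨h1.add h1', (norm_add_le _ _).trans (add_le_add h2 h2')⟩

theorem mul (hf : IsTame Λ f) (hg : IsTame Λ g) : IsTame Λ fun z => f z * g z := by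
  obtain ⟨K, hK, B, h⟩ := hf.bounded
  obtain ⟨K', hK', B', h'⟩ := hg.bounded
  refine ⟨fun z p hp => by simp only [hf.add_period z p hp, hg.add_period z p hp],
    K ∪ K', hK.union hK', B * B', fun z hz => ?_⟩
  obtain ⟨h1, h2⟩ := h z fun p hp hm => hz p hp (Or.inl hm)
  obtain ⟨h1', h2'⟩ := h' z fun p hp hm => hz p hp (Or.inr hm)
  refine ⟨h1.mul h1', (norm_mul_le _ _).trans ?_⟩
  have := (norm_nonneg _).trans h2
  gcongr

theorem const_mul (hf : IsTame Λ f) (c : ℂ) : IsTame Λ fun z => c * f z :=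
  (const Λ c).mul hf

theorem sub (hf : IsTame Λ f) (hg : IsTame Λ g) : IsTame Λ fun z => f z - g z := by
  simpa [sub_eq_add_neg] using hf.add (hg.const_mul (-1))

theorem pow (hf : IsTame Λ f) (n : ℕ) : IsTame Λ fun z => f z ^ n := by
  induction n with
  | zero => simpa using const Λ 1
  | succ n ih => simpa only [pow_succ] using ih.mul hf

theorem sum {ι : Type*} {t : Finset ι} {F : ι → ℂ → ℂ} (h : ∀ i ∈ t, IsTame Λ (F i)) :
    IsTame Λ fun z => ∑ i ∈ t, F i z := by
  classical
  induction t using Finset.induction_on with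
  | empty => simpa using const Λ 0
  | insert a t ha ih =>
    simpa only [Finset.sum_insert ha] using
      (h a (by simp)).add (ih fun i hi => h i (by simp [hi]))

theorem comp_sub_const (hf : IsTame Λ f) (c : ℂ) : IsTame Λ fun z => f (z - c) := by
  obtain ⟨K, hK, B, h⟩ := hf.bounded
  refine ⟨fun z p hp => by rw [add_sub_right_comm, hf.add_period _ p hp],
    (fun z => z + c) '' K, hK.image (by fun_prop), B, fun z hz => ?_⟩
  obtain ⟨h1, h2⟩ := h (z - c) fun p hp hm => hz p hp ⟨_, hm, by ring⟩
  exact ⟨h1.comp z (differentiableAt_id.sub_const c), h2⟩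

/-- Cauchy's estimate on unit discs: thickening `K` by `1` keeps each closed disc off the translates
of `K`, so the bound `B` survives. -/
theorem deriv (hf : IsTame Λ f) : IsTame Λ (deriv f) := by
  obtain ⟨K, hK, B, h⟩ := hf.bounded
  refine ⟨fun z p hp => ?_, Metric.cthickening 1 K, hK.cthickening, B, fun z hz => ?_⟩
  · have : (fun z => f (z + p)) = f := funext fun z => hf.add_period z p hp
    rw [← deriv_comp_add_const, this]
  · have hmem : ∀ w ∈ Metric.closedBall z 1, DifferentiableAt ℂ f w ∧ ‖f w‖ ≤ B := by
      refine fun w hw => h w fun p hp hm => hz p hp ?_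
      refine Metric.mem_cthickening_of_dist_le (z - p) (w - p) 1 K hm ?_
      rw [dist_sub_right, dist_comm]
      exact hw
    constructor
    · have hd : DifferentiableOn ℂ f (Metric.ball z 1) := fun w hw =>
        (hmem w (Metric.ball_subset_closedBall hw)).1.differentiableWithinAt
      exact (hd.analyticAt (Metric.ball_mem_nhds z one_pos)).deriv.differentiableAt
    · have hd : DifferentiableOn ℂ f (closure (Metric.ball z 1)) := fun w hw =>
        (hmem w (Metric.closure_ball_subset_closedBall hw)).1.differentiableWithinAt
      simpa using Complex.norm_deriv_le_of_forall_mem_sphere_norm_le one_pos hd.diffContOnCl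
        fun w hw => (hmem w (Metric.sphere_subset_closedBall hw)).2

theorem iteratedDeriv (hf : IsTame Λ f) (n : ℕ) : IsTame Λ (iteratedDeriv n f) := by
  induction n with
  | zero => simpa using hf
  | succ n ih => simpa only [iteratedDeriv_succ] using ih.deriv

end IsTame

/-! ### The function `𝒫`: principal part, periodicity and growth -/

/-- The principal part of an even function can be complemented by an exactly even function. -/
theorem exists_even_regular_part {P u : ℂ → ℂ} (hP : ∀ x, P (-x) = P x) (hu : AnalyticAt ℂ u 0)
    (h : P =ᶠ[𝓝[≠] 0] fun x => (x ^ 2)⁻¹ + u x) :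
    ∃ v, AnalyticAt ℂ v 0 ∧ (∀ x, v (-x) = v x) ∧ P =ᶠ[𝓝[≠] 0] fun x => (x ^ 2)⁻¹ + v x := by
  refine ⟨fun x => (u x + u (-x)) / 2, ?_, fun x => by simp [add_comm], ?_⟩
  · have : AnalyticAt ℂ (fun x => u (-x)) 0 :=
      AnalyticAt.fun_comp (f := fun x : ℂ => -x) (by simpa using hu) (by fun_prop)
    exact (hu.add this).div_const
  · have ht : Tendsto (fun x : ℂ => -x) (𝓝[≠] 0) (𝓝[≠] 0) := by
      refine tendsto_nhdsWithin_iff.2 ⟨?_, ?_⟩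
      · exact (Continuous.tendsto' (by fun_prop) 0 0 (by simp)).mono_left nhdsWithin_le_nhds
      · filter_upwards [self_mem_nhdsWithin] with x hx
        simpa using hx
    filter_upwards [h, ht.eventually h] with x h1 h2
    rw [hP, h1] at h2
    rw [h1]
    simp only [even_two.neg_pow] at h2
    linear_combination h2 / 2

/-- Reverse triangle inequality for `exp(-iw) - exp(iw)`, whose terms have norms `exp(Im w)` and
`exp(-Im w)`. -/
theorem Complex.abs_sinh_im_le_norm_sin (w : ℂ) : |Real.sinh w.im| ≤ ‖Complex.sin w‖ := by
  have h := abs_norm_sub_norm_le (Complex.exp (-w * Complex.I)) (Complex.exp (w * Complex.I))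
  rw [Complex.norm_exp, Complex.norm_exp] at h
  rw [Complex.sin, norm_div, norm_mul, Complex.norm_I, mul_one, Real.sinh_eq, abs_div]
  simp at h ⊢
  gcongr

theorem exists_inv_sin_sq_eventuallyEq :
    ∃ r, AnalyticAt ℂ r 0 ∧
      (fun w => (Complex.sin w ^ 2)⁻¹) =ᶠ[𝓝[≠] 0] fun w => (w ^ 2)⁻¹ + r w := by
  obtain ⟨g, hg, hsin⟩ := (Complex.analyticAt_sin : AnalyticAt ℂ Complex.sin 0).exists_eventuallyEq_taylor 3
  have hsin' : ∀ᶠ w in 𝓝 0, Complex.sin w = w * (1 + w ^ 2 * g w) := by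
    filter_upwards [hsin] with w hw
    rw [hw]
    simp [Finset.sum_range_succ, iteratedDeriv_succ]
    ring
  have han : AnalyticAt ℂ (fun w => 1 + w ^ 2 * g w) 0 := by fun_prop
  -- Obtained from `sin w = w(1 + w² g)` by computing `w⁻²((1 + w² g)⁻² - 1)`.
  refine ⟨fun w => -g w * (2 + w ^ 2 * g w) / (1 + w ^ 2 * g w) ^ 2, ?_, ?_⟩
  · exact (by fun_prop : AnalyticAt ℂ (fun w => -g w * (2 + w ^ 2 * g w)) 0).div (han.pow 2)
      (by simp)
  · have hne : ∀ᶠ w in 𝓝 0, 1 + w ^ 2 * g w ≠ 0 := han.continuousAt.eventually_ne (by simp)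
    filter_upwards [self_mem_nhdsWithin, hsin'.filter_mono nhdsWithin_le_nhds,
      hne.filter_mono nhdsWithin_le_nhds] with w hw h1 h2
    have hw0 : w ≠ 0 := hw
    rw [h1]
    field_simp
    ring

namespace PotentialCase

variable (C : PotentialCase)

theorem P_neg (z : ℂ) : C.P (-z) = C.P z := by
  cases C with
  | rational => simp [P]
  | simplyPeriodic ω hω => simp [P, neg_div]
  | elliptic L => simp [P]

instance : DiscreteTopology C.periods := by
  cases C with
  | rational => exact inferInstanceAs (DiscreteTopology (⊥ : AddSubgroup ℂ))
  | simplyPeriodic ω hω => exact inferInstanceAs (DiscreteTopology (AddSubgroup.zmultiples ω))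
  | elliptic L => exact inferInstanceAs (DiscreteTopology L.lattice)

theorem isClosed_periods : IsClosed (C.periods : Set ℂ) :=
  AddSubgroup.isClosed_of_discrete

theorem countable_periods : (C.periods : Set ℂ).Countable :=
  Set.countable_coe_iff.1 (countable_of_Lindelof_of_discrete (X := C.periods))

theorem P_add_period (z p : ℂ) (hp : p ∈ C.periods) : C.P (z + p) = C.P z := by
  cases C with
  | rational =>
    obtain rfl : p = 0 := hp
    simp
  | simplyPeriodic ω hω =>
    obtain ⟨n, rfl⟩ := AddSubgroup.mem_zmultiples_iff.1 hp
    have : (Real.pi : ℂ) * (z + n • ω) / ω = Real.pi * z / ω + n * Real.pi := by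
      rw [zsmul_eq_mul]
      field_simp
    have h2 (w : ℂ) : Complex.sin w ^ 2 = (1 - Complex.cos (2 * w)) / 2 := by
      rw [Complex.cos_two_mul, Complex.cos_sq']
      ring
    have h3 : 2 * (Real.pi * z / ω + n * Real.pi) =
        2 * (Real.pi * z / ω) + n * (2 * Real.pi) := by ring
    simp only [P, this, h2, h3, Complex.cos_add_int_mul_two_pi]
  | elliptic L => exact L.weierstrassP_add_coe z ⟨p, hp⟩

theorem analyticAt_P {z : ℂ} (hz : z ∉ C.periods) : AnalyticAt ℂ C.P z := by
  cases C with
  | rational =>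
    have : z ≠ 0 := hz
    exact (analyticAt_id.pow 2).inv (pow_ne_zero 2 this)
  | simplyPeriodic ω hω =>
    have hsin : Complex.sin (Real.pi * z / ω) ≠ 0 := by
      intro h
      obtain ⟨n, hn⟩ := Complex.sin_eq_zero_iff.1 h
      refine hz (AddSubgroup.mem_zmultiples_iff.2 ⟨n, ?_⟩)
      have hpi : (Real.pi : ℂ) ≠ 0 := by simp [Real.pi_ne_zero]
      field_simp at hn
      rw [zsmul_eq_mul, hn, mul_comm]
    have h1 : AnalyticAt ℂ (fun z => Complex.sin (Real.pi * z / ω)) z :=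
      AnalyticAt.fun_comp Complex.analyticAt_sin (by fun_prop)
    exact analyticAt_const.mul (((h1.pow 2).inv (pow_ne_zero 2 hsin)).sub analyticAt_const)
  | elliptic L => exact L.analyticOnNhd_weierstrassP z hz

theorem exists_P_eventuallyEq : ∃ u, AnalyticAt ℂ u 0 ∧ (∀ x, u (-x) = u x) ∧
    C.P =ᶠ[𝓝[≠] 0] fun x => (x ^ 2)⁻¹ + u x := by
  suffices ∃ u, AnalyticAt ℂ u 0 ∧ C.P =ᶠ[𝓝[≠] 0] fun x => (x ^ 2)⁻¹ + u x by
    obtain ⟨u, hu, h⟩ := this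
    exact exists_even_regular_part C.P_neg hu h
  cases C with
  | rational => exact ⟨0, analyticAt_const, by simp [P, EventuallyEq]⟩
  | simplyPeriodic ω hω =>
    obtain ⟨r, hr, h⟩ := exists_inv_sin_sq_eventuallyEq
    have hpi : (Real.pi : ℂ) ≠ 0 := by simp [Real.pi_ne_zero]
    have ht : Tendsto (fun x : ℂ => Real.pi * x / ω) (𝓝[≠] 0) (𝓝[≠] 0) := by
      refine tendsto_nhdsWithin_iff.2 ⟨?_, ?_⟩
      · exact (Continuous.tendsto' (by fun_prop) 0 0 (by simp)).mono_left nhdsWithin_le_nhds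
      · filter_upwards [self_mem_nhdsWithin] with x hx
        exact div_ne_zero (mul_ne_zero hpi hx) hω
    refine ⟨fun x => (Real.pi : ℂ) ^ 2 / ω ^ 2 * (r (Real.pi * x / ω) - 1 / 3), ?_, ?_⟩
    · have : AnalyticAt ℂ (fun x => r (Real.pi * x / ω)) 0 :=
        AnalyticAt.fun_comp (f := fun x : ℂ => Real.pi * x / ω) (by simpa using hr) (by fun_prop)
      exact analyticAt_const.mul (this.sub analyticAt_const)
    · filter_upwards [self_mem_nhdsWithin, ht.eventually h] with x hx h1
      have hx0 : x ≠ 0 := hx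
      simp only [P, h1]
      field_simp
      ring
  | elliptic L =>
    refine ⟨L.weierstrassPExcept 0, L.analyticAt_weierstrassPExcept 0,
      Eventually.of_forall fun x => ?_⟩
    have := L.weierstrassPExcept_add 0 x
    simp at this
    simp only [P, ← this]
    ring

/-- `K` is the unit disc, `ω` times the rectangle `[0,1] × [-1,1]`, or the closure of a fundamental
parallelogram. In the second case `|Im (z/ω)| > 1` off the translates, whence `‖sin(πz/ω)‖ ≥ 1`. In
the third the translates cover the plane, so the condition is vacuous and the bound `0` will do.
Requiring `0 ∈ K` covers the poles. -/
theorem isTame_P : IsTame C.periods C.P := by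
  refine ⟨C.P_add_period, ?_⟩
  suffices ∃ K, IsCompact K ∧ (0 : ℂ) ∈ K ∧
      ∃ B : ℝ, ∀ z, (∀ p ∈ C.periods, z - p ∉ K) → ‖C.P z‖ ≤ B by
    obtain ⟨K, hK, h0, B, h⟩ := this
    refine ⟨K, hK, B, fun z hz => ⟨(C.analyticAt_P fun hm => hz z hm ?_).differentiableAt, h z hz⟩⟩
    simpa using h0
  cases C with
  | rational =>
    refine ⟨Metric.closedBall 0 1, isCompact_closedBall 0 1, by simp, 1, fun z hz => ?_⟩
    have h1 : 1 < ‖z‖ := by simpa using hz 0 (zero_mem _)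
    simp only [P, norm_inv, norm_pow]
    exact inv_le_one_of_one_le₀ (one_le_pow₀ h1.le)
  | simplyPeriodic ω hω =>
    refine ⟨(fun w => w * ω) '' (Set.Icc 0 1 ×ℂ Set.Icc (-1) 1),
      (isCompact_Icc.reProdIm isCompact_Icc).image (by fun_prop),
      ⟨0, by simp [Complex.mem_reProdIm], by simp⟩,
      ‖(Real.pi : ℂ) ^ 2 / ω ^ 2‖ * (1 + ‖(1 / 3 : ℂ)‖), fun z hz => ?_⟩
    have him : 1 < |(z / ω).im| := by
      by_contra! hle
      refine hz (⌊(z / ω).re⌋ • ω) (AddSubgroup.mem_zmultiples_iff.2 ⟨_, rfl⟩)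
        ⟨z / ω - ⌊(z / ω).re⌋, ?_, ?_⟩
      · rw [Complex.mem_reProdIm]
        refine ⟨?_, by simpa using abs_le.1 hle⟩
        have h1 := Int.floor_le (z / ω).re
        have h2 := Int.lt_floor_add_one (z / ω).re
        simp only [Complex.sub_re, Complex.intCast_re, Set.mem_Icc]
        exact ⟨by linarith, by linarith⟩
      · simp only [zsmul_eq_mul]
        field_simp
    have hsin : 1 ≤ ‖Complex.sin (Real.pi * z / ω)‖ := by
      refine le_trans ?_ (Complex.abs_sinh_im_le_norm_sin _)
      rw [mul_div_assoc, Complex.im_ofReal_mul, Real.abs_sinh, abs_mul,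
        abs_of_pos Real.pi_pos]
      refine le_trans ?_ (Real.self_le_sinh_iff.2 (by positivity))
      nlinarith [Real.pi_gt_three]
    simp only [P, norm_mul]
    gcongr
    refine (norm_sub_le _ _).trans ?_
    gcongr
    rw [norm_inv, norm_pow]
    exact inv_le_one_of_one_le₀ (one_le_pow₀ hsin)
  | elliptic L =>
    refine ⟨closure (ZSpan.fundamentalDomain L.basis),
      (ZSpan.fundamentalDomain_isBounded L.basis).isCompact_closure, subset_closure ?_, 0,
      fun z hz => absurd (subset_closure (ZSpan.fract_mem_fundamentalDomain L.basis z)) ?_⟩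
    · simp [ZSpan.mem_fundamentalDomain]
    · refine hz (ZSpan.floor L.basis z) ?_
      change _ ∈ L.lattice
      rw [L.lattice_eq_span_range_basis]
      exact (ZSpan.floor L.basis z).2

end PotentialCase

/-! ### Liouville's theorem for tame functions -/

/-- A tame function all of whose singularities are removable is constant. -/
theorem IsTame.exists_eq_const {Λ : AddSubgroup ℂ} {g : ℂ → ℂ} (hg : IsTame Λ g)
    (hreg : ∀ z, (fun x => g (x + z)) ∈ laurentGerms ∅) :
    ∃ d, ∀ z, ContinuousAt g z → g z = d := by
  have hreg' : ∀ z, ∃ h, AnalyticAt ℂ h z ∧ g =ᶠ[𝓝[≠] z] h := by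
    intro z
    obtain ⟨_, h, hh, hgh⟩ := hreg z
    refine ⟨fun w => h (w - z),
      AnalyticAt.fun_comp (f := fun w : ℂ => w - z) (by simpa using hh) (by fun_prop), ?_⟩
    have ht : Tendsto (fun w : ℂ => w - z) (𝓝[≠] z) (𝓝[≠] 0) := by
      refine tendsto_nhdsWithin_iff.2 ⟨?_, ?_⟩
      · exact (Continuous.tendsto' (by fun_prop) z 0 (by simp)).mono_left nhdsWithin_le_nhds
      · filter_upwards [self_mem_nhdsWithin] with x hx
        exact sub_ne_zero.2 hx
    filter_upwards [ht.eventually hgh] with w hw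
    simpa using hw
  -- Values of `g` at its singularities are arbitrary; punctured limits replace them and give an
  -- entire function.
  let G : ℂ → ℂ := fun z => limUnder (𝓝[≠] z) g
  have hG : ∀ z h, ContinuousAt h z → g =ᶠ[𝓝[≠] z] h → G z = h z := fun z h hh hgh =>
    Tendsto.limUnder_eq ((hh.tendsto.mono_left nhdsWithin_le_nhds).congr' hgh.symm)
  have hGan : Differentiable ℂ G := by
    intro z
    obtain ⟨h, hh, hgh⟩ := hreg' z
    have : G =ᶠ[𝓝 z] h := by
      have h1 : ∀ᶠ w in 𝓝[≠] z, G w = h w := by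
        filter_upwards [eventually_eventually_nhdsWithin.2 hgh, self_mem_nhdsWithin,
          hh.eventually_analyticAt.filter_mono nhdsWithin_le_nhds] with w h1 h2 h3
        refine hG w h h3.continuousAt ?_
        rw [(isOpen_compl_singleton).nhdsWithin_eq h2] at h1
        exact h1.filter_mono nhdsWithin_le_nhds
      rw [eventually_nhdsWithin_iff] at h1
      filter_upwards [h1] with w hw
      rcases eq_or_ne w z with rfl | hne
      · exact hG w h hh.continuousAt hgh
      · exact hw hne
    exact (hh.congr this.symm).differentiableAt
  have hGg : ∀ z, ContinuousAt g z → G z = g z := fun z hz => hG z g hz EventuallyEq.rfl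
  have hGper : ∀ z, ∀ p ∈ Λ, G (z + p) = G z := by
    intro z p hp
    have h1 : map (fun w => w + p) (𝓝[≠] z) = 𝓝[≠] (z + p) :=
      (Homeomorph.addRight p).map_punctured_nhds_eq z
    have h2 : g ∘ (fun w => w + p) = g := funext fun w => hg.add_period w p hp
    simp only [G, limUnder]
    rw [← h1, map_map, h2]
  obtain ⟨K, hK, B, hB⟩ := hg.bounded
  obtain ⟨B', hB'⟩ := hK.exists_bound_of_continuousOn hGan.continuous.continuousOn
  -- Off the translates of `K` the bound for `g` applies; on them, periodicity reduces to the
  -- compact set `K`.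
  have hbdd : Bornology.IsBounded (Set.range G) := by
    refine isBounded_iff_forall_norm_le.2 ⟨max B B', ?_⟩
    rintro _ ⟨z, rfl⟩
    by_cases h : ∀ p ∈ Λ, z - p ∉ K
    · obtain ⟨h1, h2⟩ := hB z h
      rw [hGg z h1.continuousAt]
      exact h2.trans (le_max_left _ _)
    · push Not at h
      obtain ⟨p, hp, hpK⟩ := h
      have := hGper (z - p) p hp
      rw [sub_add_cancel] at this
      rw [this]
      exact (hB' _ hpK).trans (le_max_right _ _)
  exact ⟨G 0, fun z hz => (hGg z hz).symm.trans (hGan.apply_eq_apply_of_bounded hbdd z 0)⟩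

/-! ### Dependence on the integration constants -/

theorem kdvOperator_congr {q f g : ℂ → ℂ} {z : ℂ} (h : f =ᶠ[𝓝 z] g) :
    kdvOperator q f z = kdvOperator q g z := by
  simp only [kdvOperator, h.iteratedDeriv_eq, h.deriv_eq, h.eq_of_nhds]

theorem kdvOperator_sum {ι : Type*} {q : ℂ → ℂ} {t : Finset ι} {b : ι → ℂ} {g : ι → ℂ → ℂ} {z : ℂ}
    (hg : ∀ i ∈ t, AnalyticAt ℂ (g i) z) :
    kdvOperator q (fun z => ∑ i ∈ t, b i * g i z) z = ∑ i ∈ t, b i * kdvOperator q (g i) z := by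
  have h (n : ℕ) : iteratedDeriv n (fun z => ∑ i ∈ t, b i * g i z) z =
      ∑ i ∈ t, b i * iteratedDeriv n (g i) z := by
    rw [iteratedDeriv_fun_sum (f := fun i z => b i * g i z)
      fun i hi => (analyticAt_const.mul (hg i hi)).contDiffAt]
    simp only [iteratedDeriv_const_mul_field]
  have h1 := h 1
  simp only [iteratedDeriv_one] at h1
  simp only [kdvOperator, h, h1, Finset.mul_sum, ← Finset.sum_add_distrib]
  exact Finset.sum_congr rfl fun i _ => by ring

/-- On a connected set any two sequences of recursion coefficients differ by the choice of the
integration constants. -/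
theorem IsKdVRecursion.exists_eq_sum {U : Set ℂ} (hU : IsOpen U) (hU' : IsPreconnected U)
    {q : ℂ → ℂ} {f g : ℕ → ℂ → ℂ} (hf : IsKdVRecursion U q f) (hg : IsKdVRecursion U q g) (j : ℕ) :
    ∃ b : ℕ → ℂ, ∀ z ∈ U, f j z = ∑ k ∈ Finset.range (j + 1), b k * g k z := by
  have han (k : ℕ) : ∀ z ∈ U, AnalyticAt ℂ (g k) z := fun z hz =>
    (hg.differentiableOn k).analyticAt (hU.mem_nhds hz)
  induction j with
  | zero => exact ⟨1, fun z hz => by simp [hf.zero z hz, hg.zero z hz]⟩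
  | succ j ih =>
    obtain ⟨b, hb⟩ := ih
    let S : ℂ → ℂ := fun z => ∑ k ∈ Finset.range (j + 1), b k * g (k + 1) z
    have hS : ∀ z ∈ U, HasDerivAt S (kdvOperator q (f j) z) z := by
      intro z hz
      rw [kdvOperator_congr (eventually_of_mem (hU.mem_nhds hz) hb),
        kdvOperator_sum fun k _ => han k z hz]
      refine HasDerivAt.fun_sum fun k _ => ?_
      have : kdvOperator q (g k) z = deriv (g (k + 1)) z := (hg.succ k z hz).symm
      rw [this]
      exact (han (k + 1) z hz).differentiableAt.hasDerivAt.const_mul _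
    have hd : ∀ z ∈ U, HasDerivAt (fun z => f (j + 1) z - S z) 0 z := by
      intro z hz
      have h1 := ((hf.differentiableOn (j + 1)).differentiableAt (hU.mem_nhds hz)).hasDerivAt
      rw [hf.succ j z hz] at h1
      exact (h1.sub (hS z hz)).congr_deriv (sub_self _)
    obtain ⟨a, ha⟩ := hU.exists_is_const_of_deriv_eq_zero hU'
      (fun z hz => (hd z hz).differentiableAt.differentiableWithinAt) fun z hz => (hd z hz).deriv
    -- The old coefficients shift up by one index, and the new integration constant `a` becomes the
    -- coefficient of `g 0 = 1`.
    refine ⟨fun k => Nat.casesOn k a b, fun z hz => ?_⟩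
    rw [Finset.sum_range_succ']
    simp only [hg.zero z hz, mul_one]
    linear_combination ha z hz

/-! ### The regular set, and recursion coefficients of the potential -/

namespace PotentialCase

variable (C : PotentialCase) {M : ℕ} (q₀ : ℂ) (s : Fin M → ℕ) (ζ : Fin M → ℂ)

theorem regularSet_eq_compl_iUnion :
    C.regularSet ζ = (⋃ l, (fun z => z - ζ l) ⁻¹' (C.periods : Set ℂ))ᶜ := by
  ext z
  simp [regularSet]

theorem isOpen_regularSet : IsOpen (C.regularSet ζ) := by
  rw [regularSet_eq_compl_iUnion]
  exact (isClosed_iUnion_of_finite fun l =>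
    C.isClosed_periods.preimage (by fun_prop)).isOpen_compl

/-- The poles form a countable set, since the period group is discrete, and the plane minus a
countable set is connected. -/
theorem isPreconnected_regularSet : IsPreconnected (C.regularSet ζ) := by
  rw [regularSet_eq_compl_iUnion]
  refine (Set.Countable.isConnected_compl_of_one_lt_rank (by simp)
    (Set.countable_iUnion fun l => ?_)).isPreconnected
  exact C.countable_periods.preimage_of_injOn (sub_left_injective.injOn)

variable {q₀ s ζ}

theorem eventually_notMem_periods : ∀ᶠ x in 𝓝[≠] (0 : ℂ), x ∉ C.periods := by
  have h : DiscreteTopology (C.periods : Set ℂ) := inferInstanceAs (DiscreteTopology C.periods)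
  exact inf_principal_eq_bot.1 (discreteTopology_subtype_iff.1 h 0 (zero_mem C.periods))

theorem eventually_add_mem_regularSet
    (hζ : ∀ l l', l ≠ l' → ζ l - ζ l' ∉ C.periods) (l : Fin M) :
    ∀ᶠ x in 𝓝[≠] (0 : ℂ), x + ζ l ∈ C.regularSet ζ := by
  refine eventually_all.2 fun l' => ?_
  rcases eq_or_ne l l' with rfl | hne
  · simpa using C.eventually_notMem_periods
  · have : Tendsto (fun x => x + ζ l - ζ l') (𝓝[≠] 0) (𝓝 (ζ l - ζ l')) :=
      (Continuous.tendsto' (by fun_prop) _ _ (by simp)).mono_left nhdsWithin_le_nhds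
    exact this.eventually (C.isClosed_periods.isOpen_compl.mem_nhds (hζ l l' hne))

/-- The recursion is solved by polynomials in jet variables and evaluated at the derivatives of `q`.
Tameness passes from `𝒫` to these because it is stable under sums, products, translations and
derivatives. -/
theorem exists_isTame_isKdVRecursion : ∃ F : ℕ → ℂ → ℂ, (∀ j, IsTame C.periods (F j)) ∧
    IsKdVRecursion (C.regularSet ζ) (C.potential q₀ s ζ) F := by
  let U := C.regularSet ζ
  have hU : IsOpen U := C.isOpen_regularSet ζ
  -- The `n`-th derivative of the potential, written termwise; the constant `q₀` survives only for
  -- `n = 0`.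
  let Q : ℕ → ℂ → ℂ := fun n z => (if n = 0 then q₀ else 0) -
    ∑ l, (s l : ℂ) * ((s l : ℂ) + 1) * iteratedDeriv n C.P (z - ζ l)
  have hQ (n : ℕ) : ∀ z ∈ U, HasDerivAt (Q n) (Q (n + 1) z) z := by
    intro z hz
    refine ((hasDerivAt_const z _).sub (HasDerivAt.fun_sum fun l _ =>
      HasDerivAt.const_mul _ (HasDerivAt.comp_sub_const z (ζ l)
        (f' := iteratedDeriv (n + 1) C.P (z - ζ l)) ?_))).congr_deriv (by simp [Q])
    rw [iteratedDeriv_succ]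
    have := (C.analyticAt_P (hz l)).iterated_deriv n
    rw [← iteratedDeriv_eq_iterate] at this
    exact this.differentiableAt.hasDerivAt
  have hQtame (n : ℕ) : IsTame C.periods (Q n) :=
    (IsTame.const _ _).sub (IsTame.sum fun l _ =>
      ((C.isTame_P.iteratedDeriv n).comp_sub_const (ζ l)).const_mul _)
  have hq : C.potential q₀ s ζ = Q 0 := by
    ext z
    simp [potential, Q]
  let D : Derivation ℂ (MvPolynomial ℕ ℂ) (MvPolynomial ℕ ℂ) :=
    MvPolynomial.mkDerivation ℂ fun n => MvPolynomial.X (n + 1)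
  let E : MvPolynomial ℕ ℂ → ℂ → ℂ := fun p z => MvPolynomial.aeval (fun n => Q n z) p
  have hE : ∀ p, ∀ z ∈ U, HasDerivAt (E p) (E (D p) z) z := by
    intro p z hz
    induction p using MvPolynomial.induction_on with
    | C a => simpa [E, D] using hasDerivAt_const z a
    | add p r hp hr => simpa [E, Pi.add_def] using hp.add hr
    | mul_X p n hp =>
      simpa [E, D, Pi.mul_def, MvPolynomial.mkDerivation_X, add_comm, mul_comm] using
        hp.mul (hQ n z hz)
  have hEtame (p) : IsTame C.periods (E p) := by
    induction p using MvPolynomial.induction_on with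
    | C a => simpa [E] using IsTame.const _ a
    | add p r hp hr => simpa [E] using hp.add hr
    | mul_X p n hp => simpa [E] using hp.mul (hQtame n)
  obtain ⟨p, p0, hp⟩ := exists_kdvRecursion_of_derivation D (MvPolynomial.X 0)
  have hd (r) : ∀ z ∈ U, deriv (E r) z = E (D r) z := fun z hz => (hE r z hz).deriv
  have hcongr (r t : ℂ → ℂ) (h : ∀ z ∈ U, r z = t z) : ∀ z ∈ U, deriv r z = deriv t z :=
    fun z hz => EventuallyEq.deriv_eq (eventually_of_mem (hU.mem_nhds hz) h)
  refine ⟨fun j => E (p j), fun j => hEtame _,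
    fun j z hz => (hE _ z hz).differentiableAt.differentiableWithinAt,
    fun z _ => by simp [E, p0], fun j z hz => ?_⟩
  have h3 : iteratedDeriv 3 (E (p j)) z = E (D (D (D (p j)))) z := by
    simp only [iteratedDeriv_succ, iteratedDeriv_zero]
    rw [hcongr _ _ (hcongr _ _ (hd (p j))) z hz, hcongr _ _ (hd (D (p j))) z hz, hd _ z hz]
  rw [h3, hd _ z hz, hd _ z hz, hp, hq, (hQ 0 z hz).deriv]
  simp [E, D, MvPolynomial.mkDerivation_X]
  ring

/-- The summand at `ζ l` contributes an even regular part, without odd derivatives at `0`; those of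
the remaining summands are precisely the locus sums. -/
theorem exists_potential_eventuallyEq (hζ : ∀ l l', l ≠ l' → ζ l - ζ l' ∉ C.periods)
    (hDG : C.DGLocus s ζ) (l : Fin M) : ∃ e, AnalyticAt ℂ e 0 ∧
      ((fun x => C.potential q₀ s ζ (x + ζ l)) =ᶠ[𝓝[≠] 0]
        fun x => -(s l * (s l + 1)) * (x ^ 2)⁻¹ + e x) ∧
      ∀ k, 1 ≤ k → k ≤ s l → iteratedDeriv (2 * k - 1) e 0 = 0 := by
  obtain ⟨u, hu, hu_even, hP⟩ := C.exists_P_eventuallyEq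
  have h1 : AnalyticAt ℂ (fun x => q₀ - s l * (s l + 1) * u x) 0 := by fun_prop
  have h2 : ∀ l' ∈ Finset.univ.erase l, AnalyticAt ℂ
      (fun x => (s l' : ℂ) * (s l' + 1) * C.P (x + (ζ l - ζ l'))) 0 := fun l' hl' =>
    analyticAt_const.mul (AnalyticAt.fun_comp (f := fun x : ℂ => x + (ζ l - ζ l'))
      (by simpa using C.analyticAt_P (hζ l l' (Finset.ne_of_mem_erase hl').symm)) (by fun_prop))
  have h3 := Finset.analyticAt_fun_sum _ h2
  refine ⟨fun x => (q₀ - s l * (s l + 1) * u x) -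
    ∑ l' ∈ Finset.univ.erase l, (s l' : ℂ) * (s l' + 1) * C.P (x + (ζ l - ζ l')),
    h1.sub h3, ?_, fun k hk hks => ?_⟩
  · filter_upwards [hP] with x hx
    rw [potential, ← Finset.add_sum_erase _ _ (Finset.mem_univ l)]
    simp only [add_sub_cancel_right, hx, add_sub_assoc]
    ring
  · rw [iteratedDeriv_fun_sub h1.contDiffAt h3.contDiffAt,
      iteratedDeriv_odd_eq_zero_of_even (fun x => by rw [hu_even]) ⟨k - 1, by omega⟩,
      iteratedDeriv_fun_sum fun l' hl' => (h2 l' hl').contDiffAt]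
    simp only [iteratedDeriv_const_mul_field, iteratedDeriv_comp_add_const, zero_add]
    rw [hDG l k hk hks, sub_zero]

theorem comp_add_mem_laurentGerms (hs : ∀ l, 1 ≤ s l)
    (hζ : ∀ l l', l ≠ l' → ζ l - ζ l' ∉ C.periods) (hDG : C.DGLocus s ζ)
    {f : ℕ → ℂ → ℂ} (hf : IsKdVRecursion (C.regularSet ζ) (C.potential q₀ s ζ) f)
    (l : Fin M) (j : ℕ) :
    (fun x => f j (x + ζ l)) ∈ laurentGerms (evenExponents (min j (s l))) := by
  have hU := C.isOpen_regularSet ζ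
  have hmem := C.eventually_add_mem_regularSet hζ l
  obtain ⟨e, he, hq, hodd⟩ := C.exists_potential_eventuallyEq (q₀ := q₀) hζ hDG l
  induction j with
  | zero =>
    refine mem_laurentGerms_congr (g := fun _ => 1) ?_
      (mem_laurentGerms_of_analyticAt analyticAt_const)
    filter_upwards [hmem] with x hx using hf.zero _ hx
  | succ j ih =>
    have h := kdvOperator_mem_laurentGerms (hs l) (min_le_right _ _) he hq hodd ih
    rw [show min (min j (s l) + 1) (s l) = min (j + 1) (s l) by omega] at h
    refine mem_laurentGerms_of_deriv_mem ?_ (mem_laurentGerms_congr ?_ h)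
    · filter_upwards [hmem] with x hx
      exact (((hf.differentiableOn _).differentiableAt (hU.mem_nhds hx)).hasDerivAt.comp_add_const
        x (ζ l)).differentiableAt
    · filter_upwards [hmem] with x hx
      rw [deriv_comp_add_const, hf.succ j _ hx]
      simp only [kdvOperator, iteratedDeriv_comp_add_const, deriv_comp_add_const]

end PotentialCase

/-! ### The main theorem -/

theorem theorem2p9 (C : PotentialCase) (M : ℕ) (hM : 1 ≤ M)
    (s : Fin M → ℕ) (hs : ∀ l, 1 ≤ s l) (q₀ : ℂ)
    (ζ : Fin M → ℂ) (hζ : ∀ l l', l ≠ l' → ζ l - ζ l' ∉ C.periods)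
    (hDG : C.DGLocus s ζ)
    (f : ℕ → ℂ → ℂ) (hf : IsKdVRecursion (C.regularSet ζ) (C.potential q₀ s ζ) f) :
    (∀ z ∈ C.regularSet ζ, f 0 z = 1) ∧
    ∃ (d : ℕ → ℂ) (a : ℕ → Fin M → ℕ → ℂ), ∀ j, 1 ≤ j → ∀ z ∈ C.regularSet ζ,
      f j z = d j + ∑ l, ∑ k ∈ Finset.Icc 1 (min j (s l)), a j l k * C.P (z - ζ l) ^ k := by
  refine ⟨hf.zero, ?_⟩
  suffices ∀ j, ∃ (d : ℂ) (a : Fin M → ℕ → ℂ), ∀ z ∈ C.regularSet ζ,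
      f j z = d + ∑ l, ∑ k ∈ Finset.Icc 1 (min j (s l)), a l k * C.P (z - ζ l) ^ k by
    choose d a h using this
    exact ⟨d, a, fun j _ => h j⟩
  intro j
  have hU := C.isOpen_regularSet ζ
  obtain ⟨F, hFtame, hF⟩ := C.exists_isTame_isKdVRecursion (q₀ := q₀) (s := s) (ζ := ζ)
  obtain ⟨b, hb⟩ := hf.exists_eq_sum hU (C.isPreconnected_regularSet ζ) hF j
  -- `f j` is unrestricted off the regular set, so it is replaced by `T`, which agrees with it there
  -- and is tame on the whole plane.
  let T : ℂ → ℂ := fun z => ∑ k ∈ Finset.range (j + 1), b k * F k z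
  have hT : IsTame C.periods T := IsTame.sum fun k _ => (hFtame k).const_mul _
  have hTan : ∀ z ∈ C.regularSet ζ, AnalyticAt ℂ T z := fun z hz =>
    ((hf.differentiableOn j).congr fun w hw => (hb w hw).symm).analyticAt (hU.mem_nhds hz)
  obtain ⟨u, hu, hu_even, hP⟩ := C.exists_P_eventuallyEq
  choose a ha using fun l => exists_sub_sum_pow_mem_laurentGerms hu hu_even hP _
    (C.comp_add_mem_laurentGerms hs hζ hDG hf l j)
  let S : Fin M → ℂ → ℂ := fun l z =>
    ∑ k ∈ Finset.Icc 1 (min j (s l)), a l k * C.P (z - ζ l) ^ k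
  have hS (l : Fin M) {z : ℂ} (hz : z - ζ l ∉ C.periods) : AnalyticAt ℂ (S l) z := by
    refine Finset.analyticAt_fun_sum _ fun k _ => analyticAt_const.mul (AnalyticAt.pow ?_ k)
    exact AnalyticAt.fun_comp (f := fun z => z - ζ l) (C.analyticAt_P hz) (by fun_prop)
  let g : ℂ → ℂ := fun z => T z - ∑ l, S l z
  have hg : IsTame C.periods g := hT.sub (IsTame.sum fun l _ => IsTame.sum fun k _ =>
    ((C.isTame_P.comp_sub_const (ζ l)).pow k).const_mul _)
  have hgan : ∀ z ∈ C.regularSet ζ, AnalyticAt ℂ g z := fun z hz =>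
    (hTan z hz).sub (Finset.analyticAt_fun_sum _ fun l _ => hS l (hz l))
  have hgpole (l : Fin M) : (fun x => g (x + ζ l)) ∈ laurentGerms ∅ := by
    have h1 : AnalyticAt ℂ (fun x => ∑ l' ∈ Finset.univ.erase l, S l' (x + ζ l)) 0 :=
      Finset.analyticAt_fun_sum _ fun l' hl' => AnalyticAt.fun_comp (f := fun x => x + ζ l)
        (hS l' (by simpa using hζ l l' (Finset.ne_of_mem_erase hl').symm)) (by fun_prop)
    refine mem_laurentGerms_congr ?_
      (add_mem_laurentGerms (ha l) (mem_laurentGerms_of_analyticAt h1.neg))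
    filter_upwards [C.eventually_add_mem_regularSet hζ l] with x hx
    simp only [g, T, ← hb _ hx, Pi.neg_apply]
    rw [← Finset.add_sum_erase _ _ (Finset.mem_univ l)]
    simp only [S, add_sub_cancel_right]
    ring
  obtain ⟨d, hd⟩ := hg.exists_eq_const fun z => by
    by_cases hz : z ∈ C.regularSet ζ
    · exact mem_laurentGerms_of_analyticAt (AnalyticAt.fun_comp (f := fun x => x + z)
        (by simpa using hgan z hz) (by fun_prop))
    -- The principal parts were compared only at the points `ζ l`; periodicity of `g` carries this
    -- to every pole in `ζ l + Λ`.
    · obtain ⟨l, hl⟩ : ∃ l, z - ζ l ∈ C.periods := by simpa [PotentialCase.regularSet] using hz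
      convert hgpole l using 2 with x
      rw [← hg.add_period (x + ζ l) _ hl]
      congr 1
      ring
  refine ⟨d, a, fun z hz => ?_⟩
  have := hd z (hgan z hz).continuousAt
  rw [← this, hb z hz]
  simp [g, T, S]
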